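/- Let $n\ge 0$, let $A\in\mathbb R^{n\times n}$ have $n$ distinct eigenvalues $\lambda_1,\dots,\lambda_n\in(-\infty,0)$, and let $b\in\mathbb R^n$. Let $P\in\mathbb R^{n\times n}$ be an invertible matrix with $P^{-1}AP=\operatorname{diag}(\lambda_1,\dots,\lambda_n)$, and for each $i$ let $q_i$ be the left eigenvector (a row vector) of $A$ for $\lambda_i$, $q_iA=\lambda_i q_i$, normalized by $q_ip_i=1$, where $p_i$ is the $i$-th column of $P$ (so $q_i$ is the $i$-th row of $P^{-1}$). Then the infinite-time smooth zonotope $$R_a(\infty)=\Big\{\int_0^\infty e^{At}\,b\,u(t)\,dt \;:\; u:\mathbb R\to\mathbb R \text{ measurable},\ |u(t)|\le 1 \text{ for all } t\Big\}$$ generated by the pair $(A,b)$ has the $n$-dimensional Lebesgue measure $$\operatorname{vol}(R_a(\infty))=2^n\left|\det(P)\left(\prod_{1\le j_1<j_2\le n}\frac{\lambda_{j_2}-\lambda_{j_1}}{\lambda_{j_1}+\lambda_{j_2}}\right)\left(\prod_{i=1}^n\frac{q_ib}{\lambda_i}\right)\right|.$$ -/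

import Mathlib

open MeasureTheory

/-- The admissible inputs: measurable functions of time with values in `ℝ^m`, every component
of which is bounded by `1` in absolute value at every time. -/
def IsAdmissibleInput {m : ℕ} (u : ℝ → Fin m → ℝ) : Prop :=
  Measurable u ∧ ∀ t i, |u t i| ≤ 1

/-- The infinite-time smooth zonotope generated by the matrix pair `(A, B)`: the set of all
`∫_0^∞ e^{At} B u(t) dt` for admissible inputs `u` (for which the integral converges absolutely,
as it always does when the eigenvalues of `A` have negative real parts). -/
def smoothZonotope {n m : ℕ} (A : Matrix (Fin n) (Fin n) ℝ) (B : Matrix (Fin n) (Fin m) ℝ) :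
    Set (Fin n → ℝ) :=
  {x | ∃ u : ℝ → Fin m → ℝ, IsAdmissibleInput u ∧
    IntegrableOn (fun t : ℝ => (NormedSpace.exp (t • A) * B).mulVec (u t)) (Set.Ioi 0) ∧
    x = ∫ t in Set.Ioi (0 : ℝ), (NormedSpace.exp (t • A) * B).mulVec (u t)}

/-! In eigencoordinates the zonotope is the image, under `P * diagonal (P⁻¹ b)`, of the set of
moment vectors `∫ exp (lam i * t) u t` of controls with `|u| ≤ 1`. It remains to show that this
moment set has volume `2 ^ n * |cauchyProd lam|`.

Distinct exponentials form a Chebyshev system: `expDet lam t` has constant sign on increasing `t`.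
Hence a bang-bang control with `n` switches is the sign of an exponential sum in `n + 1` exponents.
It is therefore extremal for one moment when the other `n` are fixed (`extremal_switchControl`), and
`n` moments determine its switching times (`switchMoment_injOn`). The map from switching times to
moments has Jacobian `2 ^ n * |expDet lam s|`.

Bang-bang controls with `n` switches that start at `1` fill the moment set up to a null set.
Surjectivity is not shown directly: in an induction on dimension, extremality of `u` and `-u` bounds
each one-dimensional fibre, and the integral of these bounds equals the volume of the bang-bang
image (`integral_expDet_eq_integral_switchMoment`).

The integral of `expDet` over ordered times is then evaluated by splitting off the smallest time;
the recursion closes through a Lagrange interpolation identity. -/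

/-! ### Exponentials as a Chebyshev system. -/

/-- The generalized Vandermonde matrix `exp (lam i * t j)`. -/
noncomputable def expMatrix {m n : ℕ} (lam : Fin m → ℝ) (t : Fin n → ℝ) :
    Matrix (Fin m) (Fin n) ℝ :=
  Matrix.of fun i j => Real.exp (lam i * t j)

/-- The determinant of the generalized Vandermonde matrix `exp (lam i * t j)`. -/
noncomputable def expDet {n : ℕ} (lam t : Fin n → ℝ) : ℝ := (expMatrix lam t).det

/-- Induction by Rolle: dividing by one exponential and differentiating removes one term and costs
one zero. -/
theorem exp_sum_eq_zero_of_zeros : ∀ {n : ℕ} (lam c t : Fin n → ℝ), Function.Injective lam →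
    StrictMono t → (∀ j, ∑ i, c i * Real.exp (lam i * t j) = 0) → c = 0 := by
  intro n
  induction n with
  | zero => intro lam c t _ _ _; exact Subsingleton.elim _ _
  | succ n ih =>
    intro lam c t hlam ht h
    have key : ∀ j : Fin n, ∃ x ∈ Set.Ioo (t j.castSucc) (t j.succ),
        ∑ i : Fin n, (c i.succ * (lam i.succ - lam 0)) *
          Real.exp ((lam i.succ - lam 0) * x) = 0 := by
      intro j
      have hz : ∀ k, ∑ i, c i * Real.exp ((lam i - lam 0) * t k) = 0 := by
        intro k
        have : ∑ i, c i * Real.exp ((lam i - lam 0) * t k)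
            = Real.exp (-(lam 0 * t k)) * ∑ i, c i * Real.exp (lam i * t k) := by
          rw [Finset.mul_sum]
          refine Finset.sum_congr rfl fun i _ => ?_
          rw [sub_mul, sub_eq_add_neg, Real.exp_add]; ring
        rw [this, h k, mul_zero]
      have hd : ∀ x, HasDerivAt (fun x => ∑ i, c i * Real.exp ((lam i - lam 0) * x))
          (∑ i : Fin (n+1), c i * (Real.exp ((lam i - lam 0) * x) * ((lam i - lam 0) * 1))) x := by
        intro x
        refine HasDerivAt.fun_sum fun i _ => ?_
        exact (((hasDerivAt_id x).const_mul (lam i - lam 0)).exp).const_mul (c i)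
      obtain ⟨x, hx, hx0⟩ := exists_hasDerivAt_eq_zero (ht (Fin.castSucc_lt_succ (i := j)))
        (fun x _ => (hd x).continuousAt.continuousWithinAt)
        ((hz j.castSucc).trans (hz j.succ).symm) (fun x _ => hd x)
      refine ⟨x, hx, ?_⟩
      rw [Fin.sum_univ_succ] at hx0
      simp only [sub_self, zero_mul, mul_zero, zero_add] at hx0
      rw [← hx0]
      exact Finset.sum_congr rfl fun i _ => by ring
    choose τ hτ hτ0 using key
    have hτm : StrictMono τ := by
      intro a b hab
      have h1 := (hτ a).2
      have h2 := (hτ b).1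
      have h3 : t a.succ ≤ t b.castSucc := ht.monotone (by
        rw [Fin.le_def]; simp only [Fin.val_succ, Fin.val_castSucc]; exact hab)
      linarith
    have hc := ih (fun i => lam i.succ - lam 0) (fun i => c i.succ * (lam i.succ - lam 0)) τ
      (fun a b hab => Fin.succ_injective _ (hlam (by simpa using hab))) hτm hτ0
    have hcs : ∀ i : Fin n, c i.succ = 0 := by
      intro i
      have := congrFun hc i
      simp only [Pi.zero_apply, mul_eq_zero] at this
      refine this.resolve_right fun h0 => Fin.succ_ne_zero i (hlam (sub_eq_zero.1 h0))
    have h0 := h 0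
    rw [Fin.sum_univ_succ] at h0
    simp only [hcs, zero_mul, Finset.sum_const_zero, add_zero, mul_eq_zero,
      Real.exp_ne_zero, or_false] at h0
    funext i
    exact Fin.cases h0 hcs i

theorem expDet_ne_zero {n : ℕ} {lam t : Fin n → ℝ} (hlam : Function.Injective lam)
    (ht : StrictMono t) : expDet lam t ≠ 0 := by
  intro h
  obtain ⟨v, hv, hv0⟩ := Matrix.exists_vecMul_eq_zero_iff.2 h
  exact hv (exp_sum_eq_zero_of_zeros lam v t hlam ht fun j => congrFun hv0 j)

theorem continuous_expDet {n : ℕ} (lam : Fin n → ℝ) : Continuous (expDet lam) := by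
  unfold expDet expMatrix
  refine Continuous.matrix_det ?_
  refine continuous_matrix fun i j => ?_
  simp only [Matrix.of_apply]
  fun_prop

theorem convex_strictMono (n : ℕ) : Convex ℝ {t : Fin n → ℝ | StrictMono t} := by
  intro x hx y hy a b ha hb hab i j hij
  have h1 := hx hij
  have h2 := hy hij
  simp only [Pi.add_apply, Pi.smul_apply, smul_eq_mul]
  rcases ha.eq_or_lt with rfl | ha
  · have : b = 1 := by linarith
    subst this; linarith
  · have := mul_lt_mul_of_pos_left h1 ha
    have := mul_le_mul_of_nonneg_left h2.le hb
    linarith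

/-- Increasing tuples form a convex set, so the values of the continuous `expDet lam` on it form an
interval, and that interval omits `0`. -/
theorem exists_sign_expDet {n : ℕ} {lam : Fin n → ℝ} (hlam : Function.Injective lam) :
    ∃ ε : ℝ, (ε = 1 ∨ ε = -1) ∧ ∀ t : Fin n → ℝ, StrictMono t → 0 < ε * expDet lam t := by
  have hpre := (convex_strictMono n).isPreconnected.image _ (continuous_expDet lam).continuousOn
  have hord := hpre.ordConnected
  have h0 : (0 : ℝ) ∉ expDet lam '' {t : Fin n → ℝ | StrictMono t} := by
    rintro ⟨t, ht, h⟩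
    exact expDet_ne_zero hlam ht h
  let t₀ : Fin n → ℝ := fun j => (j : ℕ)
  have ht₀ : StrictMono t₀ := fun a b hab => by
    simp only [t₀]; exact_mod_cast hab
  have m₀ := Set.mem_image_of_mem (expDet lam) (show t₀ ∈ {t : Fin n → ℝ | StrictMono t} from ht₀)
  rcases lt_or_gt_of_ne (expDet_ne_zero hlam ht₀) with h | h
  · refine ⟨-1, Or.inr rfl, fun t ht => ?_⟩
    by_contra hcon
    exact h0 (hord.out m₀ (Set.mem_image_of_mem _ ht) ⟨h.le, by linarith⟩)
  · refine ⟨1, Or.inl rfl, fun t ht => ?_⟩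
    by_contra hcon
    exact h0 (hord.out (Set.mem_image_of_mem _ ht) m₀ ⟨by linarith, h.le⟩)

/-! ### Determinant expansions. -/

/-- The exponential sum with zeros `s`, obtained by adding the time `τ` as a column to the
generalized Vandermonde matrix. -/
noncomputable def expAlt {n : ℕ} (lam : Fin (n + 1) → ℝ) (s : Fin n → ℝ) (τ : ℝ) : ℝ :=
  ∑ i : Fin (n + 1), (-1) ^ (i : ℕ) * Real.exp (lam i * τ) *
    expDet (fun j => lam (i.succAbove j)) s

/-- The slot `k` enters the column expansion only through its sign. Inserting `τ` at its sorted
place thus shows that `expAlt lam s` changes sign at each `s j`. -/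
theorem expDet_insertNth {n : ℕ} (lam : Fin (n + 1) → ℝ) (s : Fin n → ℝ) (τ : ℝ)
    (k : Fin (n + 1)) :
    expDet lam (k.insertNth (α := fun _ => ℝ) τ s) = (-1) ^ (k : ℕ) * expAlt lam s τ := by
  rw [expDet, Matrix.det_succ_column _ k, expAlt, Finset.mul_sum]
  refine Finset.sum_congr rfl fun i _ => ?_
  have : (expMatrix lam (k.insertNth (α := fun _ => ℝ) τ s)).submatrix i.succAbove k.succAbove
      = expMatrix (fun j => lam (i.succAbove j)) s := by
    ext a b
    simp [expMatrix]
  rw [this, ← expDet]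
  simp only [expMatrix, Matrix.of_apply, Fin.insertNth_apply_same]
  rw [pow_add]; ring

theorem expDet_eq_sum {n : ℕ} (lam t : Fin (n + 1) → ℝ) :
    expDet lam t = ∑ k : Fin (n + 1), (-1) ^ (k : ℕ) * Real.exp (lam 0 * t k) *
      expDet (Fin.tail lam) (k.removeNth t) := by
  rw [expDet, Matrix.det_succ_row_zero]
  rfl

theorem expDet_eq_sum_perm {n : ℕ} (lam t : Fin n → ℝ) :
    expDet lam t = ∑ σ : Equiv.Perm (Fin n), ((Equiv.Perm.sign σ : ℤ) : ℝ) *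
      ∏ j, Real.exp (lam (σ j) * t j) := by
  rw [expDet, Matrix.det_apply']
  rfl

/-! ### Bang-bang controls and their switching times. -/

/-- The bang-bang control which starts with the value `1` and switches sign at the times `s`. -/
noncomputable def switchControl {n : ℕ} (s : Fin n → ℝ) (τ : ℝ) : ℝ :=
  1 + 2 * ∑ j : Fin n, (-1) ^ ((j : ℕ) + 1) * (Set.Ioi (s j)).indicator 1 τ

theorem exists_switch_index {n : ℕ} {s : Fin n → ℝ} (hs : StrictMono s) (τ : ℝ) :
    ∃ k : Fin (n + 1), ∀ j : Fin n, s j < τ ↔ (j : ℕ) < k := by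
  classical
  have hex : ∃ k : ℕ, ∀ j : Fin n, k ≤ j → ¬ s j < τ := ⟨n, fun j hj => by omega⟩
  have hle : Nat.find hex ≤ n := Nat.find_le fun j hj => by omega
  refine ⟨⟨Nat.find hex, by omega⟩, fun j => ⟨fun hj => ?_, fun hj => ?_⟩⟩
  · by_contra hcon
    exact Nat.find_spec hex j (not_lt.1 hcon) hj
  · by_contra hcon
    refine Nat.find_min hex hj fun i hi hlt => hcon ?_
    exact (hs.monotone (Fin.le_def.2 hi)).trans_lt hlt

theorem alternating_count : ∀ (n k : ℕ), k ≤ n →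
    1 + 2 * ∑ j ∈ Finset.range n, (-1 : ℝ) ^ (j + 1) * (if j < k then 1 else 0) = (-1) ^ k := by
  intro n
  induction n with
  | zero => intro k hk; obtain rfl : k = 0 := by omega
            simp
  | succ n ih =>
    intro k hk
    rw [Finset.sum_range_succ]
    rcases Nat.lt_or_ge n k with h | h
    · obtain rfl : k = n + 1 := by omega
      have h1 := ih n le_rfl
      have h2 : ∑ j ∈ Finset.range n, (-1 : ℝ) ^ (j + 1) * (if j < n + 1 then 1 else 0)
          = ∑ j ∈ Finset.range n, (-1 : ℝ) ^ (j + 1) * (if j < n then 1 else 0) := by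
        refine Finset.sum_congr rfl fun j hj => ?_
        have := Finset.mem_range.1 hj
        rw [if_pos this, if_pos (by omega)]
      rw [h2, mul_add, ← add_assoc, h1, if_pos (by omega), pow_succ]; ring
    · rw [if_neg (by omega), mul_zero, add_zero, ih k h]

theorem switchControl_eq {n : ℕ} {s : Fin n → ℝ} {τ : ℝ} {k : Fin (n + 1)}
    (hk : ∀ j : Fin n, s j < τ ↔ (j : ℕ) < k) : switchControl s τ = (-1) ^ (k : ℕ) := by
  rw [← alternating_count n k (by omega), switchControl, Finset.sum_range]
  congr 2
  refine Finset.sum_congr rfl fun j _ => ?_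
  congr 1
  by_cases h : s j < τ
  · rw [if_pos ((hk j).1 h), Set.indicator_of_mem (Set.mem_Ioi.2 h)]; rfl
  · rw [if_neg (fun h' => h ((hk j).2 h')), Set.indicator_of_notMem (by simpa using h)]

theorem measurable_switchControl {n : ℕ} (s : Fin n → ℝ) : Measurable (switchControl s) := by
  unfold switchControl
  refine Measurable.const_add (Measurable.const_mul (Finset.measurable_sum _ fun j _ => ?_) _) _
  exact (measurable_one.indicator measurableSet_Ioi).const_mul _

theorem abs_switchControl {n : ℕ} {s : Fin n → ℝ} (hs : StrictMono s) (τ : ℝ) :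
    |switchControl s τ| = 1 := by
  obtain ⟨k, hk⟩ := exists_switch_index hs τ
  rw [switchControl_eq hk, abs_neg_one_pow]

theorem strictMono_insertNth {n : ℕ} {s : Fin n → ℝ} (hs : StrictMono s) {τ : ℝ}
    (hτ : ∀ j, s j ≠ τ) {k : Fin (n + 1)} :
    StrictMono (k.insertNth (α := fun _ => ℝ) τ s) ↔ ∀ j : Fin n, s j < τ ↔ (j : ℕ) < k := by
  constructor
  · intro h j
    have e1 : (k.insertNth (α := fun _ => ℝ) τ s) (k.succAbove j) = s j := by simp
    have e2 : (k.insertNth (α := fun _ => ℝ) τ s) k = τ := by simp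
    have := h.lt_iff_lt (a := k.succAbove j) (b := k)
    rw [e1, e2] at this
    rw [this, Fin.succAbove_lt_iff_castSucc_lt, Fin.lt_def]; rfl
  · intro h a b hab
    rcases Fin.eq_self_or_eq_succAbove k a with rfl | ⟨i, rfl⟩
    · rcases Fin.eq_self_or_eq_succAbove a b with rfl | ⟨j, rfl⟩
      · exact absurd hab (lt_irrefl _)
      · simp only [Fin.insertNth_apply_same, Fin.insertNth_apply_succAbove]
        refine lt_of_le_of_ne (not_lt.1 fun hlt => ?_) (hτ j).symm
        have h1 := (h j).1 hlt
        rw [Fin.lt_succAbove_iff_le_castSucc, Fin.le_def, Fin.val_castSucc] at hab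
        omega
    · rcases Fin.eq_self_or_eq_succAbove k b with rfl | ⟨j, rfl⟩
      · simp only [Fin.insertNth_apply_same, Fin.insertNth_apply_succAbove]
        rw [h i]
        rwa [Fin.succAbove_lt_iff_castSucc_lt, Fin.lt_def] at hab
      · simp only [Fin.insertNth_apply_succAbove]
        exact hs ((Fin.strictMono_succAbove k).lt_iff_lt.1 hab)

/-- With `k` switches before `τ`, the control equals `(-1) ^ k`, which turns `expAlt` into `expDet`
at the sorted tuple. -/
theorem switchControl_mul_expAlt_pos {n : ℕ} {lam : Fin (n + 1) → ℝ} {ε : ℝ}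
    (hε : ∀ t : Fin (n + 1) → ℝ, StrictMono t → 0 < ε * expDet lam t)
    {s : Fin n → ℝ} (hs : StrictMono s) {τ : ℝ} (hτ : ∀ j, s j ≠ τ) :
    0 < ε * (switchControl s τ * expAlt lam s τ) := by
  obtain ⟨k, hk⟩ := exists_switch_index hs τ
  rw [switchControl_eq hk, ← expDet_insertNth]
  exact hε _ ((strictMono_insertNth hs hτ).2 hk)

theorem ae_notMem_range {n : ℕ} (s : Fin n → ℝ) : ∀ᵐ τ : ℝ, ∀ j, s j ≠ τ := by
  have : (Set.range s)ᶜ ∈ ae (volume : Measure ℝ) :=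
    compl_mem_ae_iff.2 ((Set.finite_range s).measure_zero _)
  filter_upwards [this] with τ hτ j hj
  exact hτ ⟨j, hj⟩

/-- Controls that agree almost everywhere on the half line have the same switching times. -/
theorem switchControl_injective {n : ℕ} {s s' : Fin n → ℝ} (hs : StrictMono s)
    (hs' : StrictMono s') (hpos : ∀ j, 0 < s j) (hpos' : ∀ j, 0 < s' j)
    (h : ∀ᵐ τ ∂volume.restrict (Set.Ioi (0 : ℝ)), switchControl s τ = switchControl s' τ) :
    s = s' := by
  have aux : ∀ (s s' : Fin n → ℝ), StrictMono s → StrictMono s' → (∀ j, 0 < s j) →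
      (∀ᵐ τ ∂volume.restrict (Set.Ioi (0 : ℝ)), switchControl s τ = switchControl s' τ) →
      ∀ j, (∀ i < j, s i = s' i) → ¬ s j < s' j := by
    intro s s' hs hs' hpos h j hj hlt
    -- `c` is the next switch of `s` after `s j`, or `s j + 1` if there is none. On the nonempty
    -- interval from `s j` to `min c (s' j)` the two controls differ exactly by the `j`-th jump.
    obtain ⟨c, hc, hc'⟩ : ∃ c, s j < c ∧ ∀ i, s j < s i → c ≤ s i := by
      by_cases hne : ∃ i, s j < s i
      · have hn : (Finset.univ.filter fun i => s j < s i).Nonempty := by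
          obtain ⟨i, hi⟩ := hne
          exact ⟨i, by simpa using hi⟩
        obtain ⟨i, hi, him⟩ := Finset.exists_min_image _ s hn
        exact ⟨s i, by simpa using hi, fun k hk => him k (by simpa using hk)⟩
      · exact ⟨s j + 1, by linarith, fun i hi => absurd ⟨i, hi⟩ hne⟩
    have hsub : Set.Ioo (s j) (min c (s' j)) ⊆
        {τ | ¬ (τ ∈ Set.Ioi (0:ℝ) → switchControl s τ = switchControl s' τ)} := by
      rintro τ ⟨h1, h2⟩ hcon
      have hτc := lt_of_lt_of_le h2 (min_le_left _ _)
      have hτs := lt_of_lt_of_le h2 (min_le_right _ _)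
      have he := hcon ((hpos j).trans h1)
      have hd : switchControl s τ - switchControl s' τ = 2 * (-1) ^ ((j : ℕ) + 1) := by
        simp only [switchControl]
        rw [add_sub_add_left_eq_sub, ← mul_sub, ← Finset.sum_sub_distrib]
        congr 1
        rw [Finset.sum_eq_single j]
        · rw [Set.indicator_of_mem (Set.mem_Ioi.2 h1),
            Set.indicator_of_notMem (by simpa using hτs.le)]
          simp
        · intro i _ hij
          rcases lt_or_gt_of_ne hij with hij | hij
          · rw [hj i hij, sub_self]
          · rw [Set.indicator_of_notMem (a := τ) (s := Set.Ioi (s i)),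
              Set.indicator_of_notMem (a := τ) (s := Set.Ioi (s' i)), sub_self]
            · simpa using (hτs.trans (hs' hij)).le
            · simpa using hτc.le.trans (hc' i (hs hij))
        · simp
      rw [he, sub_self] at hd
      have : (2 : ℝ) * (-1) ^ ((j : ℕ) + 1) ≠ 0 := by positivity
      exact this hd.symm
    rw [ae_restrict_iff' measurableSet_Ioi] at h
    have h0 := measure_mono_null hsub (ae_iff.1 h)
    rw [Real.volume_Ioo, ENNReal.ofReal_eq_zero] at h0
    have := lt_min hc hlt
    linarith
  have hall : ∀ m : ℕ, ∀ j : Fin n, (j : ℕ) < m → s j = s' j := by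
    intro m
    induction m with
    | zero => intro j hj; omega
    | succ m ih =>
      intro j hj
      have hi : ∀ i < j, s i = s' i := fun i hij => ih i (by rw [Fin.lt_def] at hij; omega)
      exact le_antisymm (not_lt.1 (aux s' s hs' hs hpos' (h.mono fun _ h => h.symm) j
        fun i hij => (hi i hij).symm)) (not_lt.1 (aux s s' hs hs' hpos h j hi))
  exact funext fun j => hall n j j.2

/-! ### Exponential moments and extremality of bang-bang controls. -/

/-- Measurable scalar controls with values in `[-1, 1]`. -/
def IsUnitControl (u : ℝ → ℝ) : Prop := Measurable u ∧ ∀ t, |u t| ≤ 1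

/-- The exponential moments of a control on the half line. -/
noncomputable def expMoment {n : ℕ} (lam : Fin n → ℝ) (u : ℝ → ℝ) (i : Fin n) : ℝ :=
  ∫ t in Set.Ioi (0 : ℝ), Real.exp (lam i * t) * u t

/-- The set of exponential moment vectors of all controls with values in `[-1, 1]`. -/
def momentSet {n : ℕ} (lam : Fin n → ℝ) : Set (Fin n → ℝ) :=
  {x | ∃ u, IsUnitControl u ∧ x = expMoment lam u}

/-- The strictly increasing families of times greater than `T`. -/
def orderedTimes (n : ℕ) (T : ℝ) : Set (Fin n → ℝ) := {t | StrictMono t ∧ ∀ j, T < t j}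

/-- The exponential moments of `switchControl s` in closed form. -/
noncomputable def switchMoment {m n : ℕ} (lam : Fin m → ℝ) (s : Fin n → ℝ) (i : Fin m) : ℝ :=
  -(1 + 2 * ∑ j : Fin n, (-1) ^ ((j : ℕ) + 1) * Real.exp (lam i * s j)) / lam i

theorem IsUnitControl.neg {u : ℝ → ℝ} (hu : IsUnitControl u) : IsUnitControl (fun t => -u t) :=
  ⟨hu.1.neg, fun t => by rw [abs_neg]; exact hu.2 t⟩

theorem isUnitControl_switchControl {n : ℕ} {s : Fin n → ℝ} (hs : StrictMono s) :
    IsUnitControl (switchControl s) :=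
  ⟨measurable_switchControl s, fun t => (abs_switchControl hs t).le⟩

theorem IsUnitControl.integrableOn_exp_mul {u : ℝ → ℝ} (hu : IsUnitControl u) {a : ℝ}
    (ha : a < 0) : IntegrableOn (fun t => Real.exp (a * t) * u t) (Set.Ioi 0) :=
  (integrableOn_exp_mul_Ioi ha 0).mul_bdd (c := 1) hu.1.aestronglyMeasurable
    (Filter.Eventually.of_forall fun t => by rw [Real.norm_eq_abs]; exact hu.2 t)

theorem expMoment_neg {n : ℕ} (lam : Fin n → ℝ) (u : ℝ → ℝ) :
    expMoment lam (fun t => -u t) = -expMoment lam u := by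
  funext i
  simp only [expMoment, mul_neg, integral_neg, Pi.neg_apply]

theorem neg_mem_momentSet {n : ℕ} {lam : Fin n → ℝ} {x : Fin n → ℝ} (hx : x ∈ momentSet lam) :
    -x ∈ momentSet lam := by
  obtain ⟨u, hu, rfl⟩ := hx
  exact ⟨_, hu.neg, (expMoment_neg lam u).symm⟩

theorem expMoment_switchControl {m n : ℕ} {lam : Fin m → ℝ} (hneg : ∀ i, lam i < 0)
    {s : Fin n → ℝ} (hpos : ∀ j, 0 < s j) :
    expMoment lam (switchControl s) = switchMoment lam s := by
  funext i
  have hi : ∀ j : Fin n, IntegrableOn (fun t => (-1 : ℝ) ^ ((j : ℕ) + 1) *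
      (Set.Ioi (s j)).indicator (fun t => Real.exp (lam i * t)) t) (Set.Ioi 0) := fun j =>
    ((integrableOn_exp_mul_Ioi (hneg i) 0).indicator measurableSet_Ioi).const_mul _
  have h1 : ∀ t, Real.exp (lam i * t) * switchControl s t = Real.exp (lam i * t) +
      2 * ∑ j : Fin n, (-1 : ℝ) ^ ((j : ℕ) + 1) *
        (Set.Ioi (s j)).indicator (fun t => Real.exp (lam i * t)) t := by
    intro t
    rw [switchControl, mul_add, mul_one, mul_left_comm, Finset.mul_sum]
    congr 2
    refine Finset.sum_congr rfl fun j _ => ?_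
    by_cases h : t ∈ Set.Ioi (s j)
    · simp only [Set.indicator_of_mem h, Pi.one_apply]; ring
    · simp only [Set.indicator_of_notMem h]; ring
  simp only [expMoment, h1]
  rw [integral_add (integrableOn_exp_mul_Ioi (hneg i) 0)
    ((integrable_finsetSum _ fun j _ => hi j).const_mul 2), integral_const_mul,
    integral_finsetSum _ fun j _ => hi j, integral_exp_mul_Ioi (hneg i)]
  have h2 : ∀ j : Fin n, ∫ t in Set.Ioi (0:ℝ), (-1 : ℝ) ^ ((j : ℕ) + 1) *
        (Set.Ioi (s j)).indicator (fun t => Real.exp (lam i * t)) t =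
      (-1 : ℝ) ^ ((j : ℕ) + 1) * (-Real.exp (lam i * s j) / lam i) := by
    intro j
    rw [integral_const_mul, setIntegral_indicator measurableSet_Ioi, Set.Ioi_inter_Ioi,
      sup_eq_right.2 (hpos j).le, integral_exp_mul_Ioi (hneg i)]
  simp only [h2, switchMoment, mul_zero, Real.exp_zero]
  rw [neg_div, neg_div, add_div, mul_div_assoc, Finset.sum_div, neg_add, ← mul_neg,
    ← Finset.sum_neg_distrib]
  congr 2
  refine Finset.sum_congr rfl fun j _ => ?_
  ring

theorem integral_expAlt_mul {n : ℕ} {lam : Fin (n + 1) → ℝ} (hneg : ∀ i, lam i < 0)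
    (s : Fin n → ℝ) {u : ℝ → ℝ} (hu : IsUnitControl u) :
    ∫ t in Set.Ioi (0 : ℝ), expAlt lam s t * u t =
      ∑ i : Fin (n + 1), (-1) ^ (i : ℕ) * expDet (fun j => lam (i.succAbove j)) s *
        expMoment lam u i := by
  have h1 : ∀ t, expAlt lam s t * u t = ∑ i : Fin (n + 1), ((-1) ^ (i : ℕ) *
      expDet (fun j => lam (i.succAbove j)) s) * (Real.exp (lam i * t) * u t) := by
    intro t
    rw [expAlt, Finset.sum_mul]
    exact Finset.sum_congr rfl fun i _ => by ring
  simp only [h1]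
  rw [integral_finsetSum _ fun i _ => (hu.integrableOn_exp_mul (hneg i)).const_mul _]
  simp only [integral_const_mul]
  rfl

theorem integrableOn_expAlt_mul {n : ℕ} {lam : Fin (n + 1) → ℝ} (hneg : ∀ i, lam i < 0)
    (s : Fin n → ℝ) {u : ℝ → ℝ} (hu : IsUnitControl u) :
    IntegrableOn (fun t => expAlt lam s t * u t) (Set.Ioi 0) := by
  have h1 : (fun t => expAlt lam s t * u t) = fun t => ∑ i : Fin (n + 1), ((-1) ^ (i : ℕ) *
      expDet (fun j => lam (i.succAbove j)) s) * (Real.exp (lam i * t) * u t) := by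
    funext t
    rw [expAlt, Finset.sum_mul]
    exact Finset.sum_congr rfl fun i _ => by ring
  rw [h1]
  exact integrable_finsetSum _ fun i _ => (hu.integrableOn_exp_mul (hneg i)).const_mul _

/-- `switchControl s` is the sign of `ε * expAlt lam s` off the switching times, hence the pointwise
maximizer. -/
theorem sign_expAlt_mul_le {n : ℕ} {lam : Fin (n + 1) → ℝ} {ε : ℝ}
    (hε : ∀ t : Fin (n + 1) → ℝ, StrictMono t → 0 < ε * expDet lam t)
    {s : Fin n → ℝ} (hs : StrictMono s) {u : ℝ → ℝ} (hu : IsUnitControl u)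
    {τ : ℝ} (hτ : ∀ j, s j ≠ τ) :
    ε * (expAlt lam s τ * u τ) ≤ ε * (expAlt lam s τ * switchControl s τ) := by
  have hp := switchControl_mul_expAlt_pos hε hs hτ
  have h1 := abs_le.1 (hu.2 τ)
  rcases (abs_eq zero_le_one).1 (abs_switchControl hs τ) with h | h <;> rw [h] at hp ⊢ <;>
  nlinarith

theorem integral_sign_expAlt_le {n : ℕ} {lam : Fin (n + 1) → ℝ} (hneg : ∀ i, lam i < 0) {ε : ℝ}
    (hε : ∀ t : Fin (n + 1) → ℝ, StrictMono t → 0 < ε * expDet lam t)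
    {s : Fin n → ℝ} (hs : StrictMono s) {u : ℝ → ℝ} (hu : IsUnitControl u) :
    ε * ∫ t in Set.Ioi (0 : ℝ), expAlt lam s t * u t ≤
      ε * ∫ t in Set.Ioi (0 : ℝ), expAlt lam s t * switchControl s t := by
  rw [← integral_const_mul, ← integral_const_mul]
  refine integral_mono_ae ((integrableOn_expAlt_mul hneg s hu).const_mul _)
    ((integrableOn_expAlt_mul hneg s (isUnitControl_switchControl hs)).const_mul _) ?_
  exact ae_restrict_of_ae ((ae_notMem_range s).mono fun τ hτ => sign_expAlt_mul_le hε hs hu hτ)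

/-- Integrating against `expAlt` gives a linear combination of moments in which only the one of
index `0` can differ. -/
theorem integral_expAlt_sub {n : ℕ} {lam : Fin (n + 1) → ℝ} (hneg : ∀ i, lam i < 0)
    (s : Fin n → ℝ) {u v : ℝ → ℝ} (hu : IsUnitControl u) (hv : IsUnitControl v)
    (h : ∀ i : Fin n, expMoment lam u i.succ = expMoment lam v i.succ) :
    (∫ t in Set.Ioi (0 : ℝ), expAlt lam s t * v t) - ∫ t in Set.Ioi (0 : ℝ), expAlt lam s t * u t
      = expDet (Fin.tail lam) s * (expMoment lam v 0 - expMoment lam u 0) := by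
  rw [integral_expAlt_mul hneg s hu, integral_expAlt_mul hneg s hv, Fin.sum_univ_succ,
    Fin.sum_univ_succ]
  simp only [h]
  have : (fun j => lam (Fin.succAbove 0 j)) = Fin.tail lam := rfl
  rw [this]
  simp only [Fin.val_zero, pow_zero, one_mul]
  ring

/-- Among all controls with given moments of index `1, …, n`, a bang-bang control with `n`
switches has extremal moment of index `0`. -/
theorem extremal_switchControl {n : ℕ} {lam : Fin (n + 1) → ℝ} (hneg : ∀ i, lam i < 0) {ε δ : ℝ}
    (hε : ∀ t : Fin (n + 1) → ℝ, StrictMono t → 0 < ε * expDet lam t)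
    (hδ1 : δ = 1 ∨ δ = -1)
    (hδ : ∀ t : Fin n → ℝ, StrictMono t → 0 < δ * expDet (Fin.tail lam) t)
    {s : Fin n → ℝ} (hs : StrictMono s) {u : ℝ → ℝ} (hu : IsUnitControl u)
    (h : ∀ i : Fin n, expMoment lam u i.succ = expMoment lam (switchControl s) i.succ) :
    ε * δ * expMoment lam u 0 ≤ ε * δ * expMoment lam (switchControl s) 0 := by
  have h1 := integral_sign_expAlt_le hneg hε hs hu
  have h2 := integral_expAlt_sub hneg s hu (isUnitControl_switchControl hs) h
  rw [← sub_nonneg, ← mul_sub, h2] at h1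
  have h3 := hδ s hs
  rw [← sub_nonneg, ← mul_sub]
  have h4 : ε * (expDet (Fin.tail lam) s *
      (expMoment lam (switchControl s) 0 - expMoment lam u 0)) =
      (δ * expDet (Fin.tail lam) s) *
        (ε * δ * (expMoment lam (switchControl s) 0 - expMoment lam u 0)) := by
    rcases hδ1 with rfl | rfl <;> ring
  rw [h4] at h1
  exact nonneg_of_mul_nonneg_right h1 h3

/-- Adjoin a further exponent. Two bang-bang controls with equal moments are both extremal for the
new moment, so that moment agrees too, and equality in the pointwise maximum forces the controls to
agree almost everywhere. -/
theorem switchMoment_injOn {n : ℕ} {lam : Fin n → ℝ} (hlam : Function.Injective lam)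
    (hneg : ∀ i, lam i < 0) : Set.InjOn (switchMoment lam) (orderedTimes n 0) := by
  rintro s ⟨hs, hpos⟩ s' ⟨hs', hpos'⟩ he
  -- Any negative exponent different from all `lam i` would do; as the `lam i` are negative, this
  -- one lies below each of them, and it is negative even for `n = 0`.
  set μ : ℝ := ∑ i, lam i - 1 with hμ
  have hμlt : ∀ i, μ < lam i := by
    intro i
    have h1 := Finset.sum_nonpos (s := Finset.univ.erase i) fun j _ => (hneg j).le
    have h2 := Finset.add_sum_erase Finset.univ lam (Finset.mem_univ i)
    linarith
  have hμ0 : μ < 0 := by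
    have := Finset.sum_nonpos (s := Finset.univ) fun i _ => (hneg i).le
    linarith
  set L : Fin (n + 1) → ℝ := Fin.cons μ lam with hL
  have hLneg : ∀ i, L i < 0 := Fin.cases hμ0 hneg
  have hLinj : Function.Injective L :=
    Fin.cons_injective_iff.2 ⟨fun ⟨i, hi⟩ => (hμlt i).ne' hi, hlam⟩
  obtain ⟨ε, hε1, hε⟩ := exists_sign_expDet hLinj
  obtain ⟨δ, hδ1, hδ⟩ := exists_sign_expDet hlam
  have hmom : ∀ i : Fin n, expMoment L (switchControl s) i.succ
      = expMoment L (switchControl s') i.succ := by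
    intro i
    have h1 := congrFun he i
    rwa [← expMoment_switchControl hneg hpos, ← expMoment_switchControl hneg hpos'] at h1
  have hu := isUnitControl_switchControl hs
  have hu' := isUnitControl_switchControl hs'
  have e1 := extremal_switchControl hLneg hε hδ1 hδ hs hu' fun i => (hmom i).symm
  have e2 := extremal_switchControl hLneg hε hδ1 hδ hs' hu hmom
  have hne : ε * δ ≠ 0 := by rcases hε1 with rfl | rfl <;> rcases hδ1 with rfl | rfl <;> norm_num
  have e0 := mul_left_cancel₀ hne (le_antisymm e1 e2)
  have hsub := integral_expAlt_sub hLneg s hu' hu fun i => (hmom i).symm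
  rw [e0, sub_self, mul_zero] at hsub
  have i1 := (integrableOn_expAlt_mul hLneg s hu').const_mul ε
  have i2 := (integrableOn_expAlt_mul hLneg s hu).const_mul ε
  -- The integrand is nonnegative almost everywhere, so its zero integral makes it vanish almost
  -- everywhere.
  have hz : ∫ t in Set.Ioi (0 : ℝ), (ε * (expAlt L s t * switchControl s t) -
      ε * (expAlt L s t * switchControl s' t)) = 0 := by
    rw [integral_sub i2 i1, integral_const_mul, integral_const_mul, ← mul_sub, hsub, mul_zero]
  have hz' := (integral_eq_zero_iff_of_nonneg_ae (ae_restrict_of_ae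
    ((ae_notMem_range s).mono fun τ hτ => sub_nonneg.2 (sign_expAlt_mul_le hε hs hu' hτ)))
    (i2.sub i1)).1 hz
  refine switchControl_injective hs hs' hpos hpos' ?_
  filter_upwards [hz', ae_restrict_of_ae (ae_notMem_range s)] with τ h1 hτ
  have hp := switchControl_mul_expAlt_pos hε hs hτ
  simp only [Pi.zero_apply] at h1
  have hpe : ε * expAlt L s τ ≠ 0 := by
    intro h0
    have : ε * (switchControl s τ * expAlt L s τ) = switchControl s τ * (ε * expAlt L s τ) := by
      ring
    rw [this, h0, mul_zero] at hp
    exact hp.false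
  refine sub_eq_zero.1 ((mul_eq_zero.1 (?_ : ε * expAlt L s τ * _ = 0)).resolve_left hpe)
  linarith

/-! ### The Jacobian of the switching-time parametrization. -/

theorem measurableSet_orderedTimes (n : ℕ) (T : ℝ) : MeasurableSet (orderedTimes n T) := by
  have : orderedTimes n T =
      (⋂ (i : Fin n) (j : Fin n) (_ : i < j), {t : Fin n → ℝ | t i < t j}) ∩
        ⋂ j : Fin n, {t : Fin n → ℝ | T < t j} := by
    ext t
    simp only [orderedTimes, StrictMono, Set.mem_ofPred_eq, Set.mem_inter_iff, Set.mem_iInter]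
  rw [this]
  refine MeasurableSet.inter (MeasurableSet.iInter fun i => MeasurableSet.iInter fun j =>
    MeasurableSet.iInter fun _ => ?_) (MeasurableSet.iInter fun j => ?_)
  · exact measurableSet_lt (measurable_pi_apply i) (measurable_pi_apply j)
  · exact measurableSet_lt measurable_const (measurable_pi_apply j)

/-- The derivative of the moments with respect to the switching times. -/
noncomputable def switchMomentDeriv {n : ℕ} (lam : Fin n → ℝ) (s : Fin n → ℝ) :
    (Fin n → ℝ) →L[ℝ] (Fin n → ℝ) :=
  LinearMap.toContinuousLinearMap (Matrix.toLin'
    (expMatrix lam s * Matrix.diagonal fun j : Fin n => 2 * (-1 : ℝ) ^ (j : ℕ)))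

/-- Differentiating the exponentials cancels the division by `lam i`, leaving the generalized
Vandermonde matrix with columns scaled by `±2`. -/
theorem hasFDerivAt_switchMoment {n : ℕ} {lam : Fin n → ℝ} (hneg : ∀ i, lam i < 0)
    (s : Fin n → ℝ) : HasFDerivAt (switchMoment lam) (switchMomentDeriv lam s) s := by
  rw [hasFDerivAt_pi']
  intro i
  have h1 : HasFDerivAt (fun s : Fin n → ℝ => switchMoment lam s i)
      ((-(1 / lam i) * 2) • ∑ j : Fin n, ((-1 : ℝ) ^ ((j : ℕ) + 1)) •
        (Real.exp (lam i * s j) • (lam i • ContinuousLinearMap.proj (R := ℝ) (φ := fun _ => ℝ) j)))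
      s := by
    have h2 : HasFDerivAt (fun s : Fin n → ℝ => ∑ j : Fin n, (-1 : ℝ) ^ ((j : ℕ) + 1) *
        Real.exp (lam i * s j)) (∑ j : Fin n, ((-1 : ℝ) ^ ((j : ℕ) + 1)) •
        (Real.exp (lam i * s j) • (lam i • ContinuousLinearMap.proj (R := ℝ) (φ := fun _ => ℝ) j)))
        s := by
      refine HasFDerivAt.fun_sum fun j _ => ?_
      exact ((((ContinuousLinearMap.proj (R := ℝ) (φ := fun _ : Fin n => ℝ) j).hasFDerivAt
        (x := s)).const_mul (lam i)).exp).const_mul _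
    have h3 := (h2.const_mul (-(1 / lam i) * 2)).const_add (-(1 / lam i))
    refine h3.congr_of_eventuallyEq (Filter.Eventually.of_forall fun x => ?_)
    simp only [switchMoment]
    ring
  refine h1.congr_fderiv ?_
  ext v
  have hne := (hneg i).ne
  simp only [switchMomentDeriv, ContinuousLinearMap.comp_apply, ContinuousLinearMap.proj_apply,
    LinearMap.coe_toContinuousLinearMap', Matrix.toLin'_apply, Matrix.mulVec, dotProduct,
    Matrix.mul_diagonal, expMatrix, Matrix.of_apply, smul_apply,
    sum_apply, smul_eq_mul]
  rw [Finset.mul_sum]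
  refine Finset.sum_congr rfl fun j _ => ?_
  field_simp
  ring

theorem abs_det_switchMomentDeriv {n : ℕ} (lam s : Fin n → ℝ) :
    |(switchMomentDeriv lam s).det| = 2 ^ n * |expDet lam s| := by
  have : (switchMomentDeriv lam s).det = LinearMap.det (Matrix.toLin'
    (expMatrix lam s * Matrix.diagonal fun j : Fin n => 2 * (-1 : ℝ) ^ (j : ℕ))) := rfl
  rw [this, LinearMap.det_toLin', Matrix.det_mul, Matrix.det_diagonal, abs_mul, mul_comm,
    Finset.abs_prod]
  simp [abs_mul, expDet]

/-! ### Iterated integrals of the determinant over ordered times. -/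

theorem integrableOn_expDet {n : ℕ} {lam : Fin n → ℝ} (hneg : ∀ i, lam i < 0) (T : ℝ) :
    IntegrableOn (expDet lam) (orderedTimes n T) := by
  have h : IntegrableOn (expDet lam) (Set.univ.pi fun _ => Set.Ioi T) := by
    have he : expDet lam = fun t => ∑ σ : Equiv.Perm (Fin n), ((Equiv.Perm.sign σ : ℤ) : ℝ) *
      ∏ j, Real.exp (lam (σ j) * t j) := funext (expDet_eq_sum_perm lam)
    rw [he]
    refine integrable_finsetSum _ fun σ _ => Integrable.const_mul ?_ _
    rw [volume_pi, Measure.restrict_pi_pi]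
    exact Integrable.fintype_prod (f := fun j x => Real.exp (lam (σ j) * x))
      fun j => integrableOn_exp_mul_Ioi (hneg (σ j)) T
  exact h.mono_set fun t ht j _ => ht.2 j

theorem integral_eq_integral_insertNth {n : ℕ} (k : Fin (n + 1))
    (f : (Fin (n + 1) → ℝ) → ℝ) :
    ∫ p : ℝ × (Fin n → ℝ), f (k.insertNth (α := fun _ => ℝ) p.1 p.2) = ∫ t, f t :=
  (volume_preserving_piFinSuccAbove (fun _ : Fin (n + 1) => ℝ) k).symm.integral_comp' f

theorem integrable_comp_insertNth {n : ℕ} (k : Fin (n + 1))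
    {f : (Fin (n + 1) → ℝ) → ℝ} (hf : Integrable f) :
    Integrable fun p : ℝ × (Fin n → ℝ) => f (k.insertNth (α := fun _ => ℝ) p.1 p.2) :=
  ((volume_preserving_piFinSuccAbove (fun _ : Fin (n + 1) => ℝ) k).symm.integrable_comp_emb
    (MeasurableEquiv.measurableEmbedding _)).2 hf

theorem measurable_insertNth {n : ℕ} (k : Fin (n + 1)) :
    Measurable fun p : ℝ × (Fin n → ℝ) => k.insertNth (α := fun _ => ℝ) p.1 p.2 :=
  (MeasurableEquiv.piFinSuccAbove (fun _ : Fin (n + 1) => ℝ) k).symm.measurable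

theorem insertNth_zero_mem_orderedTimes {n : ℕ} {T τ : ℝ} {s : Fin n → ℝ} :
    (0 : Fin (n + 1)).insertNth (α := fun _ => ℝ) τ s ∈ orderedTimes (n + 1) T ↔
      T < τ ∧ s ∈ orderedTimes n τ := by
  constructor
  · rintro ⟨h1, h2⟩
    refine ⟨by simpa using h2 0, fun i j hij => ?_, fun j => ?_⟩
    · simpa using h1 (Fin.succ_lt_succ_iff.2 hij)
    · simpa using h1 (Fin.succ_pos j)
  · rintro ⟨h1, h2, h3⟩
    refine ⟨?_, ?_⟩
    · rw [strictMono_insertNth h2 fun j => (h3 j).ne']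
      intro j
      simpa using (h3 j).le
    · refine Fin.cases (by simpa using h1) fun j => ?_
      simpa using h1.trans (h3 j)

/-- Fubini with the smallest time `τ` outermost; `τ` becomes the lower bound for the others. -/
theorem integral_expDet_succ {n : ℕ} {lam : Fin (n + 1) → ℝ} (hneg : ∀ i, lam i < 0) (T : ℝ) :
    ∫ t in orderedTimes (n + 1) T, expDet lam t = ∫ τ in Set.Ioi T,
      ∑ i : Fin (n + 1), (-1) ^ (i : ℕ) * Real.exp (lam i * τ) *
        ∫ s in orderedTimes n τ, expDet (fun j => lam (i.succAbove j)) s := by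
  have hi := (integrableOn_expDet hneg T).integrable_indicator (measurableSet_orderedTimes _ T)
  rw [← integral_indicator (measurableSet_orderedTimes _ T), ← integral_eq_integral_insertNth 0,
    Measure.volume_eq_prod, integral_prod _ (integrable_comp_insertNth 0 hi),
    ← integral_indicator measurableSet_Ioi]
  congr 1
  funext τ
  by_cases hτ : T < τ
  · rw [Set.indicator_of_mem (Set.mem_Ioi.2 hτ)]
    have h1 : ∀ s : Fin n → ℝ, (orderedTimes (n + 1) T).indicator (expDet lam)
        ((0 : Fin (n + 1)).insertNth (α := fun _ => ℝ) τ s) =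
        (orderedTimes n τ).indicator (fun s => expAlt lam s τ) s := by
      intro s
      by_cases hs : s ∈ orderedTimes n τ
      · rw [Set.indicator_of_mem hs,
          Set.indicator_of_mem (insertNth_zero_mem_orderedTimes.2 ⟨hτ, hs⟩), expDet_insertNth]
        simp
      · rw [Set.indicator_of_notMem hs,
          Set.indicator_of_notMem fun h => hs (insertNth_zero_mem_orderedTimes.1 h).2]
    simp only [h1]
    rw [integral_indicator (measurableSet_orderedTimes _ τ)]
    simp only [expAlt]
    rw [integral_finsetSum _ fun i _ => (integrableOn_expDet (fun j => hneg _) τ).const_mul _]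
    simp only [integral_const_mul]
  · rw [Set.indicator_of_notMem (by simpa using hτ)]
    have h1 : ∀ s : Fin n → ℝ, (orderedTimes (n + 1) T).indicator (expDet lam)
        ((0 : Fin (n + 1)).insertNth (α := fun _ => ℝ) τ s) = 0 := fun s =>
      Set.indicator_of_notMem (fun h => hτ (insertNth_zero_mem_orderedTimes.1 h).1) _
    simp only [h1, integral_zero]

theorem insertNth_mem_orderedTimes {n : ℕ} {τ : ℝ} {s : Fin n → ℝ} (hτ : ∀ j, s j ≠ τ)
    {k : Fin (n + 1)} :
    k.insertNth (α := fun _ => ℝ) τ s ∈ orderedTimes (n + 1) 0 ↔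
      s ∈ orderedTimes n 0 ∧ 0 < τ ∧ ∀ j : Fin n, s j < τ ↔ (j : ℕ) < k := by
  constructor
  · rintro ⟨h1, h2⟩
    have hs : StrictMono s := by
      intro i j hij
      simpa using h1 (Fin.strictMono_succAbove k hij)
    refine ⟨⟨hs, fun j => by simpa using h2 (k.succAbove j)⟩, by simpa using h2 k,
      (strictMono_insertNth hs hτ).1 h1⟩
  · rintro ⟨⟨h1, h2⟩, h3, h4⟩
    refine ⟨(strictMono_insertNth h1 hτ).2 h4, fun j => ?_⟩
    rcases Fin.eq_self_or_eq_succAbove k j with rfl | ⟨i, rfl⟩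
    · simpa using h3
    · simpa using h2 i

/-- Exactly one slot keeps the tuple increasing, and its sign is the value of the control at `τ`. -/
theorem sum_indicator_insertNth {n : ℕ} {τ : ℝ} {s : Fin n → ℝ} (hτ : ∀ j, s j ≠ τ)
    (c : ℝ) :
    ∑ k : Fin (n + 1), (-1) ^ (k : ℕ) * (orderedTimes (n + 1) 0).indicator (fun _ => c)
      (k.insertNth (α := fun _ => ℝ) τ s) =
    (orderedTimes n 0).indicator (fun s => (Set.Ioi (0 : ℝ)).indicator
      (fun τ => switchControl s τ * c) τ) s := by
  by_cases hs : s ∈ orderedTimes n 0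
  · rw [Set.indicator_of_mem hs]
    by_cases h0 : 0 < τ
    · rw [Set.indicator_of_mem (Set.mem_Ioi.2 h0)]
      obtain ⟨k, hk⟩ := exists_switch_index hs.1 τ
      rw [Finset.sum_eq_single k]
      · rw [Set.indicator_of_mem ((insertNth_mem_orderedTimes hτ).2 ⟨hs, h0, hk⟩),
          switchControl_eq hk]
      · intro l _ hl
        rw [Set.indicator_of_notMem, mul_zero]
        intro h
        have hl' := ((insertNth_mem_orderedTimes hτ).1 h).2.2
        refine hl (Fin.ext ?_)
        by_contra hne
        rcases lt_or_gt_of_ne hne with hlt | hlt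
        · have := (hl' ⟨l, by omega⟩).symm.trans (hk ⟨l, by omega⟩)
          simp only at this
          omega
        · have := (hl' ⟨k, by omega⟩).symm.trans (hk ⟨k, by omega⟩)
          simp only at this
          omega
      · simp
    · rw [Set.indicator_of_notMem (by simpa using h0)]
      refine Finset.sum_eq_zero fun k _ => ?_
      rw [Set.indicator_of_notMem, mul_zero]
      exact fun h => h0 ((insertNth_mem_orderedTimes hτ).1 h).2.1
  · rw [Set.indicator_of_notMem hs]
    refine Finset.sum_eq_zero fun k _ => ?_
    rw [Set.indicator_of_notMem, mul_zero]
    exact fun h => hs ((insertNth_mem_orderedTimes hτ).1 h).1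

/-- Expand along the row of `lam 0` and, in the `k`-th term, call the `k`-th time `τ` and the rest
`s`. For fixed `s` the slots `k` partition the half line up to a null set, and their signs assemble
to `switchControl s`; integrating over `τ` produces its moment. -/
theorem integral_expDet_eq_integral_switchMoment {n : ℕ} {lam : Fin (n + 1) → ℝ}
    (hneg : ∀ i, lam i < 0) :
    ∫ t in orderedTimes (n + 1) 0, expDet lam t =
      ∫ s in orderedTimes n 0, switchMoment lam s 0 * expDet (Fin.tail lam) s := by
  set K : ℝ × (Fin n → ℝ) → ℝ := fun p => Real.exp (lam 0 * p.1) * expDet (Fin.tail lam) p.2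
    with hK
  have hKi : IntegrableOn K (Set.Ioi 0 ×ˢ orderedTimes n 0) := by
    rw [IntegrableOn, Measure.volume_eq_prod, ← Measure.prod_restrict]
    exact (integrableOn_exp_mul_Ioi (hneg 0) 0).mul_prod
      (integrableOn_expDet (lam := Fin.tail lam) (fun i => hneg _) 0)
  have hm := measurableSet_orderedTimes (n + 1) 0
  have hG : ∀ k : Fin (n + 1), Integrable fun p : ℝ × (Fin n → ℝ) =>
      (orderedTimes (n + 1) 0).indicator (fun _ => K p)
        (k.insertNth (α := fun _ => ℝ) p.1 p.2) := by
    intro k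
    have hsub : (fun p : ℝ × (Fin n → ℝ) => k.insertNth (α := fun _ => ℝ) p.1 p.2) ⁻¹'
        orderedTimes (n + 1) 0 ⊆ Set.Ioi 0 ×ˢ orderedTimes n 0 := by
      rintro ⟨τ, s⟩ ⟨h1, h2⟩
      refine ⟨by simpa using h2 k, fun i j hij => ?_, fun j => by simpa using h2 (k.succAbove j)⟩
      simpa using h1 (Fin.strictMono_succAbove k hij)
    exact (hKi.mono_set hsub).integrable_indicator (measurable_insertNth k hm)
  have hGt : ∀ k : Fin (n + 1), Integrable fun t : Fin (n + 1) → ℝ =>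
      (orderedTimes (n + 1) 0).indicator (fun t => K (t k, k.removeNth t)) t := by
    intro k
    rw [← (volume_preserving_piFinSuccAbove (fun _ : Fin (n + 1) => ℝ) k).symm.integrable_comp_emb
      (MeasurableEquiv.measurableEmbedding _)]
    convert hG k using 1
    funext p
    have : (MeasurableEquiv.piFinSuccAbove (fun _ : Fin (n + 1) => ℝ) k).symm p =
      k.insertNth (α := fun _ => ℝ) p.1 p.2 := rfl
    rw [Function.comp_apply, this]
    simp only [Set.indicator, Fin.insertNth_apply_same, Fin.removeNth_insertNth]
  have hL : ∫ t in orderedTimes (n + 1) 0, expDet lam t = ∑ k : Fin (n + 1), (-1) ^ (k : ℕ) *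
      ∫ p : ℝ × (Fin n → ℝ), (orderedTimes (n + 1) 0).indicator (fun _ => K p)
        (k.insertNth (α := fun _ => ℝ) p.1 p.2) := by
    have h1 : ∀ t, (orderedTimes (n + 1) 0).indicator (expDet lam) t = ∑ k : Fin (n + 1),
        (-1) ^ (k : ℕ) *
          (orderedTimes (n + 1) 0).indicator (fun t => K (t k, k.removeNth t)) t := by
      intro t
      by_cases ht : t ∈ orderedTimes (n + 1) 0
      · simp only [Set.indicator_of_mem ht, hK]
        rw [expDet_eq_sum]
        simp only [mul_assoc]
      · simp only [Set.indicator_of_notMem ht, mul_zero, Finset.sum_const_zero]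
    rw [← integral_indicator hm]
    simp only [h1]
    rw [integral_finsetSum _ fun k _ => (hGt k).const_mul _]
    refine Finset.sum_congr rfl fun k _ => ?_
    rw [integral_const_mul, ← integral_eq_integral_insertNth k]
    congr 2
    funext p
    simp only [Set.indicator, Fin.insertNth_apply_same, Fin.removeNth_insertNth]
  rw [hL]
  simp only [← integral_const_mul]
  rw [← integral_finsetSum _ fun k _ => (hG k).const_mul _, Measure.volume_eq_prod,
    integral_prod_symm _ (integrable_finsetSum _ fun k _ => (hG k).const_mul _),
    ← integral_indicator (measurableSet_orderedTimes n 0)]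
  congr 1
  funext s
  have h2 : ∫ τ, ∑ k : Fin (n + 1), (-1 : ℝ) ^ (k : ℕ) * (orderedTimes (n + 1) 0).indicator
      (fun _ => K (τ, s)) (k.insertNth (α := fun _ => ℝ) τ s) =
      ∫ τ, (orderedTimes n 0).indicator (fun s => (Set.Ioi (0 : ℝ)).indicator
        (fun τ' => switchControl s τ' * K (τ, s)) τ) s :=
    integral_congr_ae ((ae_notMem_range s).mono fun τ hτ => sum_indicator_insertNth hτ _)
  refine h2.trans ?_
  by_cases hs : s ∈ orderedTimes n 0
  · simp only [Set.indicator_of_mem hs]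
    rw [← expMoment_switchControl hneg hs.2, expMoment, ← integral_mul_const,
      ← integral_indicator measurableSet_Ioi]
    congr 1
    funext τ
    simp only [Set.indicator, hK]
    split_ifs
    · ring
    · rfl
  · simp only [Set.indicator_of_notMem hs, integral_zero]

/-! ### Closed form of the determinant integral. -/

/-- The closed form of the integral of `expDet lam` over ordered positive times. -/
noncomputable def cauchyProd {n : ℕ} (lam : Fin n → ℝ) : ℝ :=
  (∏ i, -(1 / lam i)) * ∏ i, ∏ j ∈ Finset.Ioi i, (lam i - lam j) / (lam i + lam j)

theorem prod_Ioi_succAbove {n : ℕ} (f : Fin (n + 1) → Fin (n + 1) → ℝ) (i : Fin (n + 1)) :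
    ∏ a, ∏ b ∈ Finset.Ioi a, f a b =
      (∏ a : Fin n, ∏ b ∈ Finset.Ioi a, f (i.succAbove a) (i.succAbove b)) *
        ∏ a : Fin n, if i.succAbove a < i then f (i.succAbove a) i else f i (i.succAbove a) := by
  have h : ∀ {m : ℕ} (g : Fin m → Fin m → ℝ), ∏ a, ∏ b ∈ Finset.Ioi a, g a b =
      ∏ a, ∏ b, if a < b then g a b else 1 := by
    intro m g
    refine Finset.prod_congr rfl fun a _ => ?_
    rw [← Finset.filter_lt_eq_Ioi, Finset.prod_filter]
  rw [h, h fun a b => f (i.succAbove a) (i.succAbove b), Fin.prod_univ_succAbove _ i,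
    Fin.prod_univ_succAbove _ i]
  simp only [lt_irrefl, if_false, one_mul]
  have h2 : ∀ a : Fin n, (∏ b, if i.succAbove a < b then f (i.succAbove a) b else 1) =
      (if i.succAbove a < i then f (i.succAbove a) i else 1) *
        ∏ b : Fin n, if a < b then f (i.succAbove a) (i.succAbove b) else 1 := by
    intro a
    rw [Fin.prod_univ_succAbove _ i]
    simp only [(Fin.strictMono_succAbove i).lt_iff_lt]
  simp only [h2, Finset.prod_mul_distrib]
  rw [← mul_assoc, mul_comm, ← Finset.prod_mul_distrib]
  congr 1
  refine Finset.prod_congr rfl fun a _ => ?_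
  rcases lt_or_gt_of_ne (Fin.succAbove_ne i a) with hlt | hlt
  · simp [hlt, hlt.not_gt]
  · simp [hlt, hlt.not_gt]

theorem prod_neg_one_below {n : ℕ} (i : Fin (n + 1)) :
    ∏ a : Fin n, (if i.succAbove a < i then (-1 : ℝ) else 1) = (-1) ^ (i : ℕ) := by
  rw [Finset.prod_ite, Finset.prod_const, Finset.prod_const_one, mul_one]
  congr 1
  have : (Finset.univ.filter fun a : Fin n => i.succAbove a < i) =
      Finset.univ.filter fun a : Fin n => (a : ℕ) < i := by
    ext a
    rw [Finset.mem_filter, Finset.mem_filter, Fin.succAbove_lt_iff_castSucc_lt, Fin.lt_def,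
      Fin.val_castSucc]
  rw [this, Fin.card_filter_val_lt]
  omega

/-- Lagrange interpolation at the nodes `lam i` for `∏ (X + lam j) - ∏ (X - lam j)`, of degree at
most `n`: its coefficient at `X ^ n` is `2 * ∑ lam i`, and at each node only the first product
survives. -/
theorem sum_mul_prod_add_div_sub {n : ℕ} {lam : Fin (n + 1) → ℝ} (hlam : Function.Injective lam) :
    ∑ i, lam i * ∏ a : Fin n, (lam i + lam (i.succAbove a)) / (lam i - lam (i.succAbove a)) =
      ∑ i, lam i := by
  classical
  set P : Polynomial ℝ := ∏ j, (Polynomial.X - Polynomial.C (-lam j)) with hP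
  set Q : Polynomial ℝ := ∏ j, (Polynomial.X - Polynomial.C (lam j)) with hQ
  have hPm : P.Monic := Polynomial.monic_prod_X_sub_C _ _
  have hQm : Q.Monic := Polynomial.monic_prod_X_sub_C _ _
  have hPd : P.degree = ((n + 1 : ℕ) : WithBot ℕ) := by
    rw [hP, Polynomial.degree_prod]; simp
  have hQd : Q.degree = ((n + 1 : ℕ) : WithBot ℕ) := by
    rw [hQ, Polynomial.degree_prod]; simp
  have hdeg : (P - Q).degree < ((Finset.univ : Finset (Fin (n + 1))).card : WithBot ℕ) := by
    rw [Finset.card_univ, Fintype.card_fin, ← hPd]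
    exact Polynomial.degree_sub_lt_left (hPd.trans hQd.symm) hPm.ne_zero
      (hPm.leadingCoeff.trans hQm.leadingCoeff.symm)
  have hc := Lagrange.coeff_eq_sum (s := Finset.univ) (v := lam) hlam.injOn hdeg
  have e1 := Polynomial.prod_X_sub_C_coeff_card_pred (Finset.univ : Finset (Fin (n + 1)))
    (fun j => -lam j) (by simp)
  have e2 := Polynomial.prod_X_sub_C_coeff_card_pred (Finset.univ : Finset (Fin (n + 1)))
    lam (by simp)
  rw [Polynomial.coeff_sub, e1, e2, Finset.sum_neg_distrib] at hc
  have h3 : ∀ i, Polynomial.eval (lam i) (P - Q) / ∏ j ∈ Finset.univ.erase i, (lam i - lam j) =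
      2 * (lam i * ∏ a : Fin n, (lam i + lam (i.succAbove a)) /
        (lam i - lam (i.succAbove a))) := by
    intro i
    have hq : Polynomial.eval (lam i) Q = 0 := by
      rw [hQ, Polynomial.eval_prod]
      exact Finset.prod_eq_zero (Finset.mem_univ i) (by simp)
    have hp : Polynomial.eval (lam i) P =
        2 * lam i * ∏ a : Fin n, (lam i + lam (i.succAbove a)) := by
      rw [hP, Polynomial.eval_prod, Fin.prod_univ_succAbove _ i]
      simp [two_mul]
    have hd : ∏ j ∈ Finset.univ.erase i, (lam i - lam j) =
        ∏ a : Fin n, (lam i - lam (i.succAbove a)) := by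
      have : Finset.univ.erase i = Finset.univ.image i.succAbove := by
        ext j
        simp only [Finset.mem_erase, Finset.mem_univ, and_true, Finset.mem_image, true_and]
        exact Fin.exists_succAbove_eq_iff.symm
      rw [this, Finset.prod_image Fin.succAbove_right_injective.injOn]
    rw [Polynomial.eval_sub, hq, hp, hd, Finset.prod_div_distrib]
    ring
  simp only [h3] at hc
  rw [← Finset.mul_sum] at hc
  linarith

/-- Splitting off the factors that involve `lam i` leaves the summands of the interpolation
identity; reordering the pairs with smaller index absorbs `(-1) ^ i`. -/
theorem sum_cauchyProd_succAbove {n : ℕ} {lam : Fin (n + 1) → ℝ} (hlam : Function.Injective lam)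
    (hneg : ∀ i, lam i < 0) :
    ∑ i : Fin (n + 1), (-1) ^ (i : ℕ) * cauchyProd (fun j => lam (i.succAbove j)) =
      -(∑ i, lam i) * cauchyProd lam := by
  have h : ∀ i : Fin (n + 1), (-1) ^ (i : ℕ) * cauchyProd (fun j => lam (i.succAbove j)) =
      -((lam i * ∏ a : Fin n, (lam i + lam (i.succAbove a)) / (lam i - lam (i.succAbove a))) *
        cauchyProd lam) := by
    intro i
    have h1 : ∏ a : Fin n, (if i.succAbove a < i then
        (lam (i.succAbove a) - lam i) / (lam (i.succAbove a) + lam i) else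
        (lam i - lam (i.succAbove a)) / (lam i + lam (i.succAbove a))) = (-1) ^ (i : ℕ) *
        ∏ a : Fin n, (lam i - lam (i.succAbove a)) / (lam i + lam (i.succAbove a)) := by
      rw [← prod_neg_one_below i, ← Finset.prod_mul_distrib]
      refine Finset.prod_congr rfl fun a _ => ?_
      split_ifs
      · rw [add_comm (lam (i.succAbove a)), ← neg_sub, neg_div, neg_one_mul]
      · rw [one_mul]
    have h2 : (∏ a : Fin n, (lam i + lam (i.succAbove a)) / (lam i - lam (i.succAbove a))) *
        ∏ a : Fin n, (lam i - lam (i.succAbove a)) / (lam i + lam (i.succAbove a)) = 1 := by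
      rw [← Finset.prod_mul_distrib]
      refine Finset.prod_eq_one fun a _ => ?_
      have ha : lam i - lam (i.succAbove a) ≠ 0 :=
        sub_ne_zero.2 fun h => Fin.succAbove_ne i a (hlam h).symm
      have hb : lam i + lam (i.succAbove a) ≠ 0 := (add_neg (hneg _) (hneg _)).ne
      field_simp
    rw [cauchyProd, cauchyProd, prod_Ioi_succAbove _ i, h1, Fin.prod_univ_succAbove _ i]
    have h0 := (hneg i).ne
    generalize (∏ a : Fin n, (lam i + lam (i.succAbove a)) / (lam i - lam (i.succAbove a))) = A
      at h2 ⊢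
    generalize (∏ a : Fin n, (lam i - lam (i.succAbove a)) / (lam i + lam (i.succAbove a))) = B
      at h2 ⊢
    generalize (∏ a : Fin n, -(1 / lam (i.succAbove a))) = C
    generalize (∏ a : Fin n, ∏ b ∈ Finset.Ioi a,
      (lam (i.succAbove a) - lam (i.succAbove b)) / (lam (i.succAbove a) + lam (i.succAbove b))) = E
    have : -(lam i * A * (-(1 / lam i) * C * (E * ((-1) ^ (i : ℕ) * B)))) =
        (lam i * (1 / lam i)) * (A * B) * ((-1) ^ (i : ℕ) * (C * E)) := by ring
    rw [this, h2, mul_one_div_cancel h0, one_mul, one_mul]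
  simp only [h]
  rw [Finset.sum_neg_distrib, ← Finset.sum_mul, sum_mul_prod_add_div_sub hlam, neg_mul]

/-- The integral of the generalized Vandermonde determinant over ordered times. -/
theorem integral_expDet_orderedTimes : ∀ {n : ℕ} {lam : Fin n → ℝ}, Function.Injective lam →
    (∀ i, lam i < 0) → ∀ T : ℝ, ∫ t in orderedTimes n T, expDet lam t =
      Real.exp ((∑ i, lam i) * T) * cauchyProd lam := by
  intro n
  induction n with
  | zero =>
    intro lam _ _ T
    have h1 : orderedTimes 0 T = Set.univ :=
      Set.eq_univ_of_forall fun t => ⟨fun a => a.elim0, fun a => a.elim0⟩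
    have h2 : ∀ t : Fin 0 → ℝ, expDet lam t = 1 := fun t => Matrix.det_isEmpty
    simp [h1, h2, cauchyProd, volume_pi, Measure.real]
  | succ n ih =>
    intro lam hlam hneg T
    have hS : ∑ i, lam i < 0 := Finset.sum_neg (fun i _ => hneg i) Finset.univ_nonempty
    rw [integral_expDet_succ hneg]
    -- The induction hypothesis at `T = τ` supplies the missing exponents, so every summand has the
    -- same exponential factor.
    have h1 : ∀ τ, ∑ i : Fin (n + 1), (-1) ^ (i : ℕ) * Real.exp (lam i * τ) *
        ∫ s in orderedTimes n τ, expDet (fun j => lam (i.succAbove j)) s =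
        Real.exp ((∑ i, lam i) * τ) * (-(∑ i, lam i) * cauchyProd lam) := by
      intro τ
      rw [← sum_cauchyProd_succAbove hlam hneg, Finset.mul_sum]
      refine Finset.sum_congr rfl fun i _ => ?_
      rw [ih (lam := fun j => lam (i.succAbove j))
        (hlam.comp Fin.succAbove_right_injective) (fun j => hneg _),
        Fin.sum_univ_succAbove _ i, add_mul, Real.exp_add]
      ring
    simp only [h1]
    rw [integral_mul_const, integral_exp_mul_Ioi hS]
    have := hS.ne
    field_simp

/-! ### The volume of the moment set. -/

theorem switchMoment_mem_momentSet {n : ℕ} {lam : Fin n → ℝ} (hneg : ∀ i, lam i < 0)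
    {s : Fin n → ℝ} (hs : s ∈ orderedTimes n 0) : switchMoment lam s ∈ momentSet lam :=
  ⟨_, isUnitControl_switchControl hs.1, (expMoment_switchControl hneg hs.2).symm⟩

theorem measurableSet_image_switchMoment {n : ℕ} {lam : Fin n → ℝ}
    (hlam : Function.Injective lam) (hneg : ∀ i, lam i < 0) :
    MeasurableSet (switchMoment lam '' orderedTimes n 0) :=
  measurable_image_of_fderivWithin (measurableSet_orderedTimes n 0)
    (fun s _ => (hasFDerivAt_switchMoment hneg s).hasFDerivWithinAt)
    (switchMoment_injOn hlam hneg)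

theorem volume_image_switchMoment {n : ℕ} {lam : Fin n → ℝ} (hlam : Function.Injective lam)
    (hneg : ∀ i, lam i < 0) {ε : ℝ} (hε1 : ε = 1 ∨ ε = -1)
    (hε : ∀ t : Fin n → ℝ, StrictMono t → 0 < ε * expDet lam t) :
    volume (switchMoment lam '' orderedTimes n 0) =
      ENNReal.ofReal (2 ^ n * (ε * ∫ t in orderedTimes n 0, expDet lam t)) := by
  rw [← lintegral_abs_det_fderiv_eq_addHaar_image volume (measurableSet_orderedTimes n 0)
    (fun s _ => (hasFDerivAt_switchMoment hneg s).hasFDerivWithinAt)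
    (switchMoment_injOn hlam hneg), ← integral_const_mul, ← integral_const_mul,
    ofReal_integral_eq_lintegral_ofReal
      (((integrableOn_expDet hneg 0).const_mul ε).const_mul (2 ^ n))
      ((ae_restrict_mem (measurableSet_orderedTimes n 0)).mono fun t ht =>
        mul_nonneg (by positivity) (hε t ht.1).le)]
  refine setLIntegral_congr_fun (measurableSet_orderedTimes n 0) fun t ht => ?_
  have h := hε t ht.1
  simp only [abs_det_switchMomentDeriv]
  congr 2
  rcases hε1 with rfl | rfl
  · rw [one_mul] at h ⊢
    rw [abs_of_pos h]
  · rw [abs_of_neg (by linarith)]; ring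

theorem abs_expMoment_le {n : ℕ} {lam : Fin n → ℝ} (hneg : ∀ i, lam i < 0) {u : ℝ → ℝ}
    (hu : IsUnitControl u) (i : Fin n) :
    |expMoment lam u i| ≤ ∫ t in Set.Ioi (0 : ℝ), Real.exp (lam i * t) := by
  rw [expMoment, ← Real.norm_eq_abs]
  refine norm_integral_le_of_norm_le (integrableOn_exp_mul_Ioi (hneg i) 0)
    (Filter.Eventually.of_forall fun t => ?_)
  rw [Real.norm_eq_abs, abs_mul, Real.abs_exp]
  exact mul_le_of_le_one_right (Real.exp_pos _).le (hu.2 t)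

theorem volume_setOf_sign_mul_mem {σ a b : ℝ} (hσ : σ = 1 ∨ σ = -1) :
    volume {x : ℝ | a ≤ σ * x ∧ σ * x ≤ b} = ENNReal.ofReal (b - a) := by
  rcases hσ with rfl | rfl
  · have : {x : ℝ | a ≤ 1 * x ∧ 1 * x ≤ b} = Set.Icc a b := by
      ext x; simp
    rw [this, Real.volume_Icc]
  · have : {x : ℝ | a ≤ -1 * x ∧ -1 * x ≤ b} = Set.Icc (-b) (-a) := by
      ext x
      simp only [Set.mem_ofPred_eq, Set.mem_Icc]
      constructor <;> rintro ⟨h1, h2⟩ <;> constructor <;> linarith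
    rw [this, Real.volume_Icc]
    congr 1; ring

/-- A function on the image of the switching times which is prescribed by the switching times
extends to a measurable function. -/
theorem exists_measurable_switchMoment {n : ℕ} {lam : Fin n → ℝ} (hlam : Function.Injective lam)
    (hneg : ∀ i, lam i < 0) {f : (Fin n → ℝ) → ℝ} (hf : Measurable f) :
    ∃ g : (Fin n → ℝ) → ℝ, Measurable g ∧
      ∀ s ∈ orderedTimes n 0, g (switchMoment lam s) = f s := by
  have he := measurableEmbedding_of_fderivWithin (measurableSet_orderedTimes n 0)
    (fun s _ => (hasFDerivAt_switchMoment hneg s).hasFDerivWithinAt)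
    (switchMoment_injOn hlam hneg)
  obtain ⟨g, hg, hgf⟩ := he.exists_measurable_extend (hf.comp measurable_subtype_coe)
    fun _ => inferInstance
  exact ⟨g, hg, fun s hs => congrFun hgf ⟨s, hs⟩⟩

theorem measurable_switchMoment_apply {m n : ℕ} (lam : Fin m → ℝ) (i : Fin m) :
    Measurable fun s : Fin n → ℝ => switchMoment lam s i := by
  have : Continuous fun s : Fin n → ℝ => switchMoment lam s i := by
    unfold switchMoment
    fun_prop
  exact this.measurable

/-- Over almost every tail moment vector `y`, both `y` and `-y` are bang-bang. Extremality for `u`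
and `-u` then confines `σ` times the moment of index `0` to `[-g (-y), g y]`. By symmetry these
lengths integrate to `2 * ∫ g`, which a change of variables identifies with the volume on the right.
-/
theorem volume_momentSet_succ_le {n : ℕ} {lam : Fin (n + 1) → ℝ} (hlam : Function.Injective lam)
    (hneg : ∀ i, lam i < 0)
    (ih : volume (momentSet (Fin.tail lam)) ≤
      volume (switchMoment (Fin.tail lam) '' orderedTimes n 0)) :
    volume (momentSet lam) ≤ volume (switchMoment lam '' orderedTimes (n + 1) 0) := by
  have hneg' : ∀ i, Fin.tail lam i < 0 := fun i => hneg _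
  have hlam' : Function.Injective (Fin.tail lam) := hlam.comp (Fin.succ_injective n)
  obtain ⟨ε, hε1, hε⟩ := exists_sign_expDet hlam
  obtain ⟨δ, hδ1, hδ⟩ := exists_sign_expDet hlam'
  set Z := momentSet (Fin.tail lam) with hZ
  set O := orderedTimes n 0 with hO
  set Y := switchMoment (Fin.tail lam) '' O with hY
  have hOm : MeasurableSet O := measurableSet_orderedTimes n 0
  have hYm : MeasurableSet Y := measurableSet_image_switchMoment hlam' hneg'
  have hYZ : Y ⊆ Z := by
    rintro _ ⟨s, hs, rfl⟩
    exact switchMoment_mem_momentSet hneg' hs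
  have hYfin : volume Y ≠ ⊤ := by
    rw [hY, volume_image_switchMoment hlam' hneg' hδ1 hδ]
    exact ENNReal.ofReal_ne_top
  -- Here the induction hypothesis enters; finiteness of `volume Y` permits the subtraction.
  have hZY : volume (Z \ Y) = 0 := by
    rw [measure_sdiff hYZ hYm.nullMeasurableSet hYfin, tsub_eq_zero_of_le ih]
  have hZnY : volume (Z \ -Y) = 0 := by
    have : Z \ -Y = -(Z \ Y) := by
      ext y
      simp only [Set.mem_sdiff, Set.mem_neg]
      constructor
      · rintro ⟨h1, h2⟩; exact ⟨neg_mem_momentSet h1, h2⟩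
      · rintro ⟨h1, h2⟩
        have := neg_mem_momentSet h1
        rw [neg_neg] at this
        exact ⟨this, h2⟩
    rw [this, Measure.measure_neg, hZY]
  have hnYZ : -Y ⊆ Z := fun y hy => by
    have := neg_mem_momentSet (hYZ (Set.mem_neg.1 hy))
    rwa [neg_neg] at this
  have hσ : ε * δ = 1 ∨ ε * δ = -1 := by
    rcases hε1 with rfl | rfl <;> rcases hδ1 with rfl | rfl <;> norm_num
  set σ := ε * δ with hσd
  obtain ⟨g, hgm, hg⟩ := exists_measurable_switchMoment hlam' hneg'
    ((measurable_switchMoment_apply (n := n) lam 0).const_mul σ)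
  -- the extremal property of bang-bang controls, in terms of `g`
  have hext : ∀ u, IsUnitControl u → expMoment (Fin.tail lam) u ∈ Y →
      σ * expMoment lam u 0 ≤ g (expMoment (Fin.tail lam) u) := by
    rintro u hu ⟨s, hs, he⟩
    rw [← he, hg s hs, ← expMoment_switchControl hneg hs.2]
    refine extremal_switchControl hneg hε hδ1 hδ hs.1 hu fun i => ?_
    rw [expMoment_switchControl hneg hs.2]
    exact (congrFun he i).symm
  set A : Set (ℝ × (Fin n → ℝ)) := {p | p.2 ∈ Y ∩ -Y ∧ -g (-p.2) ≤ σ * p.1 ∧ σ * p.1 ≤ g p.2}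
    with hA
  have hcover : (fun p : ℝ × (Fin n → ℝ) => (0 : Fin (n + 1)).insertNth (α := fun _ => ℝ)
      p.1 p.2) ⁻¹' momentSet lam ⊆ A ∪ Set.univ ×ˢ (Z \ Y ∪ Z \ -Y) := by
    rintro ⟨x, y⟩ ⟨u, hu, he⟩
    have hx : x = expMoment lam u 0 := by simpa using congrFun he 0
    have hy : y = expMoment (Fin.tail lam) u := by
      funext i
      have hi := congrFun he i.succ
      simp only [Fin.insertNth_zero', Fin.cons_succ] at hi
      exact hi
    have hyZ : y ∈ Z := ⟨u, hu, hy⟩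
    by_cases h1 : y ∈ Y
    · by_cases h2 : y ∈ -Y
      · refine Or.inl ⟨⟨h1, h2⟩, ?_, ?_⟩
        · have hn : -y = expMoment (Fin.tail lam) fun t => -u t := by rw [expMoment_neg, hy]
          have := hext _ hu.neg (hn ▸ Set.mem_neg.1 h2)
          rw [← hn, expMoment_neg, Pi.neg_apply, ← hx] at this
          simp only
          linarith
        · simp only
          rw [hx, hy]
          exact hext u hu (hy ▸ h1)
      · exact Or.inr ⟨trivial, Or.inr ⟨hyZ, h2⟩⟩
    · exact Or.inr ⟨trivial, Or.inl ⟨hyZ, h1⟩⟩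
  have hAm : MeasurableSet A := by
    refine MeasurableSet.inter (measurable_snd (hYm.inter hYm.neg)) (MeasurableSet.inter ?_ ?_)
    · exact measurableSet_le (hgm.comp measurable_snd.neg).neg (measurable_fst.const_mul σ)
    · exact measurableSet_le (measurable_fst.const_mul σ) (hgm.comp measurable_snd)
  have hle : volume (momentSet lam) ≤ volume A := by
    rw [← (volume_preserving_piFinSuccAbove (fun _ : Fin (n + 1) => ℝ) 0).symm.measure_preimage_equiv]
    refine (measure_mono hcover).trans ((measure_union_le _ _).trans ?_)
    rw [Measure.volume_eq_prod, Measure.prod_prod, measure_union_null hZY hZnY, mul_zero, add_zero]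
  refine hle.trans ?_
  -- integrability of `g`
  set C := ∫ t in Set.Ioi (0 : ℝ), Real.exp (lam 0 * t) with hC
  have hgb : ∀ y ∈ Y, ‖g y‖ ≤ C := by
    rintro _ ⟨s, hs, rfl⟩
    rw [hg s hs, Real.norm_eq_abs, abs_mul, ← expMoment_switchControl hneg hs.2]
    have h1 : |σ| = 1 := by rcases hσ with h | h <;> rw [h] <;> norm_num
    rw [h1, one_mul]
    exact abs_expMoment_le hneg (isUnitControl_switchControl hs.1) 0
  have hgY : IntegrableOn g Y :=
    Measure.integrableOn_of_bounded (M := C) hYfin hgm.aestronglyMeasurable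
      ((ae_restrict_mem hYm).mono hgb)
  have hgn : IntegrableOn (fun y => g (-y)) (-Y) :=
    ((Measure.measurePreserving_neg (volume : Measure (Fin n → ℝ))).integrableOn_comp_preimage
      (MeasurableEquiv.neg (Fin n → ℝ)).measurableEmbedding).2 hgY
  have hgnint : ∫ y in -Y, g (-y) = ∫ y in Y, g y :=
    (Measure.measurePreserving_neg (volume : Measure (Fin n → ℝ))).setIntegral_preimage_emb
      (MeasurableEquiv.neg (Fin n → ℝ)).measurableEmbedding g Y
  have hYY : (Y ∩ -Y : Set (Fin n → ℝ)) =ᵐ[volume] Y := by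
    refine Filter.EventuallyLE.antisymm (Set.inter_subset_left.eventuallyLE) ?_
    rw [ae_le_set]
    refine measure_mono_null ?_ hZnY
    rintro y ⟨h1, h2⟩
    exact ⟨hYZ h1, fun h3 => h2 ⟨h1, h3⟩⟩
  have hYY' : (Y ∩ -Y : Set (Fin n → ℝ)) =ᵐ[volume] (-Y : Set (Fin n → ℝ)) := by
    refine Filter.EventuallyLE.antisymm (Set.inter_subset_right.eventuallyLE) ?_
    rw [ae_le_set]
    refine measure_mono_null ?_ hZY
    rintro y ⟨h1, h2⟩
    exact ⟨hnYZ h1, fun h3 => h2 ⟨h3, h1⟩⟩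
  have hvolA : volume A = ENNReal.ofReal (2 * ∫ y in Y, g y) := by
    have hslice : ∀ y, volume ((fun x : ℝ => (x, y)) ⁻¹' A) =
        (Y ∩ -Y).indicator (fun y => ENNReal.ofReal (g y + g (-y))) y := by
      intro y
      by_cases hy : y ∈ Y ∩ -Y
      · have : (fun x : ℝ => (x, y)) ⁻¹' A = {x | -g (-y) ≤ σ * x ∧ σ * x ≤ g y} := by
          ext x
          exact ⟨fun h => h.2, fun h => ⟨hy, h⟩⟩
        rw [Set.indicator_of_mem hy, this, volume_setOf_sign_mul_mem hσ, sub_neg_eq_add]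
      · have : (fun x : ℝ => (x, y)) ⁻¹' A = ∅ := by
          ext x
          exact ⟨fun h => hy h.1, fun h => h.elim⟩
        rw [Set.indicator_of_notMem hy, this, measure_empty]
    rw [Measure.volume_eq_prod, Measure.prod_apply_symm hAm]
    simp only [hslice]
    rw [lintegral_indicator (hYm.inter hYm.neg), ← ofReal_integral_eq_lintegral_ofReal
      (f := fun y => g y + g (-y)) ((hgY.mono_set Set.inter_subset_left).add (hgn.mono_set Set.inter_subset_right)),
      integral_add (hgY.mono_set Set.inter_subset_left) (hgn.mono_set Set.inter_subset_right),
      setIntegral_congr_set hYY, setIntegral_congr_set hYY', hgnint, two_mul]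
    -- The fibre length is nonnegative because the moment of the bang-bang control itself lies
    -- between the two bounds.
    refine (ae_restrict_mem (hYm.inter hYm.neg)).mono ?_
    rintro y ⟨⟨s, hs, rfl⟩, h2⟩
    have e1 := (expMoment_switchControl hneg' hs.2)
    have hu := isUnitControl_switchControl hs.1
    have e2 := hext _ hu (e1 ▸ ⟨s, hs, rfl⟩)
    have e3 : expMoment (Fin.tail lam) (fun t => -switchControl s t) =
      -switchMoment (Fin.tail lam) s := by rw [expMoment_neg, e1]
    have e4 := hext _ hu.neg (e3 ▸ Set.mem_neg.1 h2)
    rw [e3, expMoment_neg, Pi.neg_apply] at e4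
    rw [e1] at e2
    simp only [Pi.zero_apply]
    linarith
  rw [hvolA, volume_image_switchMoment hlam hneg hε1 hε,
    integral_expDet_eq_integral_switchMoment hneg, hY,
    integral_image_eq_integral_abs_det_fderiv_smul volume hOm
      (fun s _ => (hasFDerivAt_switchMoment hneg' s).hasFDerivWithinAt)
      (switchMoment_injOn hlam' hneg')]
  refine ENNReal.ofReal_le_ofReal (le_of_eq ?_)
  rw [← integral_const_mul, ← integral_const_mul, ← integral_const_mul]
  refine setIntegral_congr_fun hOm fun s hs => ?_
  have h := hδ s hs.1
  simp only [abs_det_switchMomentDeriv, smul_eq_mul]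
  rw [hg s hs, hσd]
  -- The absolute value is `δ * expDet`, and `δ * δ = 1` leaves only the sign `ε`.
  rcases hδ1 with rfl | rfl
  · rw [one_mul] at h
    rw [abs_of_pos h]; ring
  · rw [abs_of_neg (by linarith)]; ring

/-- Almost every point of the moment set is attained by a bang-bang control with `n` switches. -/
theorem volume_momentSet_eq_image : ∀ {n : ℕ} {lam : Fin n → ℝ}, Function.Injective lam →
    (∀ i, lam i < 0) →
    volume (momentSet lam) = volume (switchMoment lam '' orderedTimes n 0) := by
  intro n lam hlam hneg
  refine le_antisymm ?_ (measure_mono ?_)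
  · induction n with
    | zero =>
      refine measure_mono fun x _ => ⟨x, ⟨fun a => a.elim0, fun a => a.elim0⟩, ?_⟩
      exact Subsingleton.elim _ _
    | succ n ih =>
      exact volume_momentSet_succ_le hlam hneg
        (ih (lam := Fin.tail lam) (hlam.comp (Fin.succ_injective n)) fun i => hneg _)
  · rintro _ ⟨s, hs, rfl⟩
    exact switchMoment_mem_momentSet hneg hs

theorem volume_momentSet {n : ℕ} {lam : Fin n → ℝ} (hlam : Function.Injective lam)
    (hneg : ∀ i, lam i < 0) :
    volume (momentSet lam) = ENNReal.ofReal (2 ^ n * |cauchyProd lam|) := by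
  obtain ⟨ε, hε1, hε⟩ := exists_sign_expDet hlam
  have hI : ∫ t in orderedTimes n 0, expDet lam t = cauchyProd lam := by
    rw [integral_expDet_orderedTimes hlam hneg, mul_zero, Real.exp_zero, one_mul]
  have h0 : 0 ≤ ε * cauchyProd lam := by
    rw [← hI, ← integral_const_mul]
    exact setIntegral_nonneg (measurableSet_orderedTimes n 0) fun t ht => (hε t ht.1).le
  rw [volume_momentSet_eq_image hlam hneg, volume_image_switchMoment hlam hneg hε1 hε, hI]
  congr 2
  rcases hε1 with rfl | rfl
  · rw [one_mul] at h0 ⊢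
    exact (abs_of_nonneg h0).symm
  · rw [abs_of_nonpos (by linarith)]; ring

/-! ### From the moment set to the zonotope. -/

/-- Since `exp (t • A) = P * diagonal (exp (lam i * t)) * P⁻¹` and the diagonal entries commute with
those of `P⁻¹ b`, the time dependence sits in the vector `exp (lam i * t) * u t`, and a constant
linear map leaves the integral. -/
theorem smoothZonotope_eq_image {n : ℕ} {A P : Matrix (Fin n) (Fin n) ℝ} {b lam : Fin n → ℝ}
    (hneg : ∀ i, lam i < 0) (hP : IsUnit P.det)
    (hdiag : P⁻¹ * A * P = Matrix.diagonal lam) :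
    smoothZonotope A (Matrix.replicateCol (Fin 1) b) =
      Matrix.toLin' (P * Matrix.diagonal (P⁻¹.mulVec b)) '' momentSet lam := by
  have hPu : IsUnit P := (Matrix.isUnit_iff_isUnit_det P).2 hP
  have hA : A = P * Matrix.diagonal lam * P⁻¹ := by
    rw [← hdiag, ← Matrix.mul_assoc, ← Matrix.mul_assoc, Matrix.mul_nonsing_inv P hP,
      Matrix.one_mul, Matrix.mul_assoc, Matrix.mul_nonsing_inv P hP, Matrix.mul_one]
  have hexp : ∀ t : ℝ, NormedSpace.exp (t • A) =
      P * Matrix.diagonal (fun i => Real.exp (lam i * t)) * P⁻¹ := by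
    intro t
    have h1 : t • A = P * Matrix.diagonal (t • lam) * P⁻¹ := by
      rw [hA, Matrix.diagonal_smul, Matrix.mul_smul, Matrix.smul_mul]
    rw [h1, Matrix.exp_conj _ _ hPu, Matrix.exp_diagonal]
    congr 3
    funext i
    rw [Pi.coe_exp, ← Real.exp_eq_exp_ℝ, Pi.smul_apply, smul_eq_mul, mul_comm]
  set L := LinearMap.toContinuousLinearMap
    (Matrix.toLin' (P * Matrix.diagonal (P⁻¹.mulVec b))) with hL
  have hint : ∀ (u : ℝ → Fin 1 → ℝ) (t : ℝ),
      (NormedSpace.exp (t • A) * Matrix.replicateCol (Fin 1) b).mulVec (u t) =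
        L fun i => Real.exp (lam i * t) * u t 0 := by
    intro u t
    have h1 : (Matrix.replicateCol (Fin 1) b).mulVec (u t) = u t 0 • b := by
      funext i
      simp [Matrix.mulVec, dotProduct, mul_comm]
    rw [hexp, ← Matrix.mulVec_mulVec, h1, hL, LinearMap.coe_toContinuousLinearMap',
      Matrix.toLin'_apply, ← Matrix.mulVec_mulVec, ← Matrix.mulVec_mulVec, ← Matrix.mulVec_mulVec,
      Matrix.mulVec_smul]
    congr 1
    funext i
    simp only [Matrix.mulVec_diagonal, Pi.smul_apply, smul_eq_mul]
    ring
  have hI : ∀ v : ℝ → ℝ, IsUnitControl v → IntegrableOn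
      (fun t => (fun i => Real.exp (lam i * t) * v t : Fin n → ℝ)) (Set.Ioi 0) := fun v hv =>
    Integrable.of_eval fun i => hv.integrableOn_exp_mul (hneg i)
  have hval : ∀ v : ℝ → ℝ, IsUnitControl v →
      ∫ t in Set.Ioi (0 : ℝ), L (fun i => Real.exp (lam i * t) * v t) = L (expMoment lam v) := by
    intro v hv
    rw [L.integral_comp_comm (hI v hv)]
    congr 1
    funext i
    exact eval_integral (fun i => hv.integrableOn_exp_mul (hneg i)) i
  ext x
  constructor
  · rintro ⟨u, ⟨hum, hub⟩, -, rfl⟩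
    have hv : IsUnitControl fun t => u t 0 :=
      ⟨(measurable_pi_apply 0).comp hum, fun t => hub t 0⟩
    refine ⟨_, ⟨_, hv, rfl⟩, ?_⟩
    simp only [hint]
    exact (hval _ hv).symm
  · rintro ⟨_, ⟨v, hv, rfl⟩, rfl⟩
    refine ⟨fun t _ => v t, ⟨measurable_pi_lambda _ fun _ => hv.1, fun t _ => hv.2 t⟩, ?_, ?_⟩
    · simp only [fun t => hint (fun t _ => v t) t]
      exact L.integrable_comp (hI v hv)
    · simp only [fun t => hint (fun t _ => v t) t]
      exact (hval v hv).symm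

/-- Normalized left eigenvectors are the rows of the inverse of the eigenvector matrix. -/
theorem left_eigenvector_eq_inv_row {n : ℕ} {A P : Matrix (Fin n) (Fin n) ℝ} {lam : Fin n → ℝ}
    (hdist : Function.Injective lam) (hP : IsUnit P.det)
    (hdiag : P⁻¹ * A * P = Matrix.diagonal lam) {q : Fin n → Fin n → ℝ}
    (hq : ∀ i, Matrix.vecMul (q i) A = lam i • q i) (hunit : ∀ i, q i ⬝ᵥ P.col i = 1)
    (i : Fin n) : q i = P⁻¹.row i := by
  have hAP : A * P = P * Matrix.diagonal lam := by
    rw [← hdiag, ← Matrix.mul_assoc, ← Matrix.mul_assoc, Matrix.mul_nonsing_inv P hP,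
      Matrix.one_mul]
  have h1 : Matrix.vecMul (q i) P = Pi.single i 1 := by
    funext j
    by_cases hij : j = i
    · subst hij
      rw [Pi.single_eq_same]
      exact hunit j
    · rw [Pi.single_eq_of_ne hij]
      -- The `j`-th entry of `q i * A * P` is both `lam i` and `lam j` times that of `q i * P`, so
      -- it vanishes for `j ≠ i`.
      have h2 := congrFun (congrArg (Matrix.vecMul (q i)) hAP) j
      rw [← Matrix.vecMul_vecMul, hq, Matrix.smul_vecMul, ← Matrix.vecMul_vecMul,
        Matrix.vecMul_diagonal, Pi.smul_apply, smul_eq_mul, mul_comm, ← sub_eq_zero,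
        ← mul_sub] at h2
      exact (mul_eq_zero.1 h2).resolve_right fun h => hij (hdist (sub_eq_zero.1 h)).symm
  have h3 := congrArg (fun v => Matrix.vecMul v P⁻¹) h1
  simp only [Matrix.vecMul_vecMul, Matrix.mul_nonsing_inv P hP, Matrix.vecMul_one,
    Matrix.single_one_vecMul] at h3
  exact h3

theorem theorem2 (n : ℕ) (A : Matrix (Fin n) (Fin n) ℝ) (b : Fin n → ℝ)
    (lam : Fin n → ℝ)
    (hlam : ∀ i, Module.End.HasEigenvalue (Matrix.toLin' A) (lam i))
    (hdist : Function.Injective lam)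
    (hneg : ∀ i, lam i < 0)
    (P : Matrix (Fin n) (Fin n) ℝ) (hP : IsUnit P.det)
    (hdiag : P⁻¹ * A * P = Matrix.diagonal lam)
    (q : Fin n → Fin n → ℝ)
    (hq : ∀ i, Matrix.vecMul (q i) A = lam i • q i)
    (hunit : ∀ i, q i ⬝ᵥ P.col i = 1) :
    volume (smoothZonotope A (Matrix.replicateCol (Fin 1) b)) =
      ENNReal.ofReal (2 ^ n *
        |P.det *
          (∏ j₁ : Fin n, ∏ j₂ ∈ Finset.Ioi j₁, (lam j₂ - lam j₁) / (lam j₁ + lam j₂)) *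
          (∏ i : Fin n, (q i ⬝ᵥ b) / lam i)|) := by
  have hqb : P⁻¹.mulVec b = fun i => q i ⬝ᵥ b := by
    funext i
    rw [left_eigenvector_eq_inv_row hdist hP hdiag hq hunit i]
    rfl
  rw [smoothZonotope_eq_image hneg hP hdiag, Measure.addHaar_image_linearMap,
    volume_momentSet hdist hneg, LinearMap.det_toLin', Matrix.det_mul, Matrix.det_diagonal, hqb,
    ← ENNReal.ofReal_mul (abs_nonneg _)]
  congr 1
  have h1 : |∏ j₁ : Fin n, ∏ j₂ ∈ Finset.Ioi j₁, (lam j₂ - lam j₁) / (lam j₁ + lam j₂)| =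
      |∏ j₁ : Fin n, ∏ j₂ ∈ Finset.Ioi j₁, (lam j₁ - lam j₂) / (lam j₁ + lam j₂)| := by
    simp only [Finset.abs_prod, abs_div]
    refine Finset.prod_congr rfl fun i _ => Finset.prod_congr rfl fun j _ => ?_
    rw [abs_sub_comm]
  have h2 : |∏ i, -(1 / lam i)| = |∏ i, 1 / lam i| := by
    simp only [Finset.abs_prod, abs_neg]
  rw [cauchyProd, abs_mul, abs_mul, abs_mul, abs_mul, h1, h2]
  simp only [div_eq_mul_inv, one_mul, Finset.prod_mul_distrib, abs_mul]
  ring
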